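/- Let $G$ be a finite group and let $\operatorname{Irr} G$ be the set of its irreducible complex characters. For $X\subseteq \operatorname{Irr} G$ put $\sigma_X=\sum_{\chi\in X}\chi(1)\chi$. For a set $\mathcal X$ of subsets of $\operatorname{Irr} G$ let $\operatorname{Clpt}(\mathcal X)$ be the partition of $G$ into the equivalence classes of the relation: $g\sim h$ if and only if $\sigma_X(g)=\sigma_X(h)$ for all $X\in\mathcal X$. A subset of $G$ is called normal if it is a union of conjugacy classes of $G$. For a set $\mathcal K$ of normal subsets of $G$ let $\operatorname{Irpt}(\mathcal K)$ be the partition of $\operatorname{Irr} G$ into the equivalence classes of the relation: $\chi\sim\psi$ if and only if $\frac{1}{\chi(1)}\sum_{g\in K}\chi(g)=\frac{1}{\psi(1)}\sum_{g\in K}\psi(g)$ for all $K\in\mathcal K$. A partition of $G$ is called $G$-invariant if all its members are normal subsets of $G$. A pair $(\mathcal X,\mathcal K)$ of a partition $\mathcal X$ of $\operatorname{Irr} G$ and a partition $\mathcal K$ of $G$ is a supercharacter theory of $G$ if $|\mathcal X|=|\mathcal K|$ and, for every $X\in\mathcal X$, $\sigma_X$ is constant on each member of $\mathcal K$. A partition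 $\mathcal P$ refines a partition $\mathcal Q$ of the same set if every member of $\mathcal P$ is contained in a member of $\mathcal Q$. Let $\mathcal K$ be a $G$-invariant partition of $G$ and $\mathcal X$ a partition of $\operatorname{Irr} G$. Then: (a) $|\mathcal K|\le|\operatorname{Irpt}(\mathcal K)|$, and equality holds if and only if $(\operatorname{Irpt}(\mathcal K),\mathcal K)$ is a supercharacter theory. (b) $|\mathcal X|\le|\operatorname{Clpt}(\mathcal X)|$, and equality holds if and only if $(\mathcal X,\operatorname{Clpt}(\mathcal X))$ is a supercharacter theory. (c) $\operatorname{Clpt}(\operatorname{Irpt}(\mathcal K))$ refines $\mathcal K$, and these partitions are equal if and only if $(\operatorname{Irpt}(\mathcal K),\mathcal K)$ is a supercharacter theory. (d) $\operatorname{Irpt}(\operatorname{Clpt}(\mathcal X))$ refines $\mathcal X$, and these partitions are equal if and only if $(\mathcal X,\operatorname{Clpt}(\mathcal X))$ is a supercharacter theory. -/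

import Mathlib

namespace Superchar

/-- The set `Irr G` of irreducible complex characters of `G`, as functions `G → ℂ`. Every
finite-dimensional complex representation is isomorphic to one on some `Fin n → ℂ`, and
isomorphic representations have the same character. -/
def irrSet (G : Type*) [Group G] : Set (G → ℂ) :=
  {χ | ∃ (n : ℕ) (ρ : Representation ℂ G (Fin n → ℂ)), ρ.IsIrreducible ∧ ρ.character = χ}

/-- The type of irreducible complex characters of `G`. -/
abbrev Irr (G : Type*) [Group G] : Type _ := ↥(irrSet G)

/-- A finite group has only finitely many irreducible characters, so that the sums over sets of
characters below are ordinary finite sums. -/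
instance finite_irr (G : Type*) [Group G] [Finite G] : Finite (Irr G) := by
  classical
  have : Fintype G := Fintype.ofFinite G
  have hc : (Nat.card G : ℂ) ≠ 0 := Nat.cast_ne_zero.mpr Nat.card_pos.ne'
  have : Invertible (Nat.card G : ℂ) := invertibleOfNonzero hc
  have key : ∀ χ ψ : Irr G, (Nat.card G : ℂ)⁻¹ * ∑ g : G, χ.1 g * ψ.1 g⁻¹ =
      if χ = ψ then 1 else 0 := by
    rintro ⟨_, n, ρ, hρ, rfl⟩ ⟨_, m, τ, hτ, rfl⟩
    split_ifs with h
    · have h' : ρ.character = τ.character := congrArg Subtype.val h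
      simp only [← h']
      rw [Representation.char_orthonormal, if_pos ⟨Representation.Equiv.refl ρ⟩]
    · simp only []
      rw [Representation.char_orthonormal, if_neg]
      rintro ⟨e⟩
      exact h (Subtype.ext (Representation.char_iso e).symm)
  have hli : LinearIndependent ℂ (fun χ : Irr G => χ.1) := by
    rw [linearIndependent_iff']
    intro s c hs ψ hψ
    have h1 : (Nat.card G : ℂ)⁻¹ * ∑ g : G, (∑ χ ∈ s, c χ • χ.1) g * ψ.1 g⁻¹ = 0 := by
      rw [hs]; simp
    have h2 : (Nat.card G : ℂ)⁻¹ * ∑ g : G, (∑ χ ∈ s, c χ • χ.1) g * ψ.1 g⁻¹ =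
        ∑ χ ∈ s, c χ * ((Nat.card G : ℂ)⁻¹ * ∑ g : G, χ.1 g * ψ.1 g⁻¹) := by
      simp only [Finset.sum_apply, Pi.smul_apply, smul_eq_mul, Finset.sum_mul, Finset.mul_sum]
      rw [Finset.sum_comm]
      refine Finset.sum_congr rfl fun _ _ => Finset.sum_congr rfl fun _ _ => by ring
    rw [h2] at h1
    simp only [key] at h1
    simpa [hψ] using h1
  exact hli.finite

section

variable {G : Type*} [Group G] [Finite G]

/-- `σ_X = ∑_{χ ∈ X} χ(1) χ` for a set `X` of irreducible characters. -/
noncomputable def sigma (X : Set (Irr G)) (g : G) : ℂ :=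
  ∑ χ ∈ X.toFinite.toFinset, χ.1 1 * χ.1 g

/-- The value `χ(K̂) = ∑_{g ∈ K} χ(g)` of (the linear extension of) a character at the sum
`K̂ = ∑_{g ∈ K} g` in the group algebra. -/
noncomputable def charSum (χ : Irr G) (K : Set G) : ℂ :=
  ∑ g ∈ K.toFinite.toFinset, χ.1 g

/-- `g ∼ h` iff `σ_X(g) = σ_X(h)` for all `X ∈ 𝒳`. -/
def clSetoid (𝒳 : Set (Set (Irr G))) : Setoid G where
  r g h := ∀ X ∈ 𝒳, sigma X g = sigma X h
  iseqv := ⟨fun _ _ _ => rfl, fun h X hX => (h X hX).symm,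
    fun h₁ h₂ X hX => (h₁ X hX).trans (h₂ X hX)⟩

/-- The partition of `G` into the classes of `clSetoid 𝒳`. -/
def Clpt (𝒳 : Set (Set (Irr G))) : Set (Set G) := (clSetoid 𝒳).classes

/-- `χ ∼ ψ` iff `χ(K̂) / χ(1) = ψ(K̂) / ψ(1)` for all `K ∈ 𝒦`. -/
def irSetoid (𝒦 : Set (Set G)) : Setoid (Irr G) where
  r χ ψ := ∀ K ∈ 𝒦, charSum χ K / χ.1 1 = charSum ψ K / ψ.1 1
  iseqv := ⟨fun _ _ _ => rfl, fun h K hK => (h K hK).symm,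
    fun h₁ h₂ K hK => (h₁ K hK).trans (h₂ K hK)⟩

/-- The partition of `Irr G` into the classes of `irSetoid 𝒦`. -/
def Irpt (𝒦 : Set (Set G)) : Set (Set (Irr G)) := (irSetoid 𝒦).classes

/-- A pair of a partition `𝒳` of `Irr G` and a partition `𝒦` of `G` is a supercharacter theory
if `|𝒳| = |𝒦|` and all `σ_X`, `X ∈ 𝒳`, are constant on the members of `𝒦`. -/
structure IsSupercharacterTheory (𝒳 : Set (Set (Irr G))) (𝒦 : Set (Set G)) : Prop where
  isPartition_irr : Setoid.IsPartition 𝒳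
  isPartition_group : Setoid.IsPartition 𝒦
  card_eq : 𝒳.ncard = 𝒦.ncard
  const : ∀ X ∈ 𝒳, ∀ K ∈ 𝒦, ∀ g ∈ K, ∀ h ∈ K, sigma X g = sigma X h

end

/-- All members of `𝒦` are normal subsets of `G`, that is, unions of conjugacy classes. -/
def IsGInvariant {G : Type*} [Group G] (𝒦 : Set (Set G)) : Prop :=
  ∀ K ∈ 𝒦, ∀ x ∈ K, ∀ g : G, g * x * g⁻¹ ∈ K

/-- `P` refines `Q`: every block of `P` is contained in a block of `Q`. -/
def Refines {S : Type*} (P Q : Set (Set S)) : Prop :=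
  ∀ A ∈ P, ∃ B ∈ Q, A ⊆ B

end Superchar

/-! Replace a partition by the space `F` of complex functions constant on its blocks: its dimension
is the number of blocks, and finer partitions have larger spaces. Let `T` = `centralTransform` send
`f` to `χ ↦ (∑ f(g) χ(g)) / χ(1)` and `S` = `idempotentTransform` send `c` to `∑ c(χ) χ(1) conj χ`.
Then `T S = |G|` by row orthogonality, and `S T = |G|` on class functions because the irreducible
characters separate those. Evaluation on indicators gives the dictionary: `T F(𝒦) ≤ F(𝒳)` iff `𝒳`
refines `Irpt 𝒦`, and `S F(𝒳) ≤ F(𝒦)` iff `𝒦` refines `Clpt 𝒳`, that is, iff all `σ_X` are constant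
on the blocks of `𝒦`. So `T` embeds `F(𝒦)` in `F(Irpt 𝒦)`, which gives the inequality in (a). If the
cardinalities agree, `T` is onto, so `S` maps `F(Irpt 𝒦)` back into `F(𝒦)`, which is the
supercharacter condition. For (c), `F(𝒦) = S T F(𝒦) ≤ S F(Irpt 𝒦) ≤ F(Clpt (Irpt 𝒦))`. Parts (b) and
(d) are dual. -/

namespace Superchar

open scoped ComplexConjugate MonoidAlgebra ComplexOrder

/-! ### Unitarity of characters and completeness of the irreducible characters -/

section Representations

variable {G : Type*} [Group G]

/-- The character of a complex matrix representation of a finite group at an inverse is the complex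
conjugate of its value: the representation preserves a positive definite Hermitian form. -/
theorem character_inv_eq_conj [Finite G] {n : ℕ} (ρ : Representation ℂ G (Fin n → ℂ)) (g : G) :
    ρ.character g⁻¹ = conj (ρ.character g) := by
  classical
  have := Fintype.ofFinite G
  let M : G → Matrix (Fin n) (Fin n) ℂ := fun g => LinearMap.toMatrix' (ρ g)
  have hmul : ∀ a b, M (a * b) = M a * M b := fun a b => by
    simp only [M, map_mul]; exact LinearMap.toMatrix'_comp _ _
  have hone : M 1 = 1 := by simp only [M, map_one]; exact LinearMap.toMatrix'_id
  have htr : ∀ a, ρ.character a = (M a).trace := fun a => by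
    rw [Representation.character, LinearMap.trace_eq_matrix_trace ℂ (Pi.basisFun ℂ (Fin n))]
    rfl
  let P : Matrix (Fin n) (Fin n) ℂ := ∑ a, (M a).conjTranspose * M a
  have hP : P.PosDef := by
    -- The term of the identity element alone is positive definite; the others are only used as
    -- semidefinite.
    rw [show P = (M 1).conjTranspose * M 1 +
      ∑ a ∈ Finset.univ.erase 1, (M a).conjTranspose * M a from
        (Finset.add_sum_erase _ _ (Finset.mem_univ 1)).symm]
    refine Matrix.PosDef.add_posSemidef ?_ ?_
    · rw [hone, Matrix.conjTranspose_one, one_mul]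
      exact Matrix.PosDef.one
    · exact Matrix.posSemidef_sum _ fun a _ => Matrix.posSemidef_conjTranspose_mul_self _
  -- Invariance of the averaged form, by the substitution `a ↦ a * g`. It makes `M g⁻¹` similar to
  -- the adjoint of `M g`, so the traces agree.
  have hinv : (M g).conjTranspose * P = P * M g⁻¹ := by
    simp only [P, Finset.mul_sum, Finset.sum_mul]
    symm
    rw [← Equiv.sum_comp (Equiv.mulRight g)]
    refine Finset.sum_congr rfl fun a _ => ?_
    simp only [Equiv.coe_mulRight]
    rw [mul_assoc, ← hmul, mul_inv_cancel_right, hmul, Matrix.conjTranspose_mul, mul_assoc]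
  obtain ⟨u, hu⟩ := hP.isUnit
  have : M g⁻¹ = (↑u⁻¹ : Matrix (Fin n) (Fin n) ℂ) * ((M g).conjTranspose * (↑u : Matrix (Fin n) (Fin n) ℂ)) := by
    rw [hu, hinv, ← hu, Units.inv_mul_cancel_left]
  rw [htr, htr, this, Matrix.trace_mul_comm, mul_assoc, Units.mul_inv, mul_one,
    Matrix.trace_conjTranspose]
  rfl

/-- The group algebra element with coefficients `f`. -/
noncomputable def groupAlgebraElement [Fintype G] (f : G → ℂ) : ℂ[G] :=
  ∑ g, MonoidAlgebra.single g (f g)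

omit [Group G] in
theorem groupAlgebraElement_apply [Fintype G] (f : G → ℂ) (g : G) :
    (groupAlgebraElement f).coeff g = f g := by
  classical
  simp [groupAlgebraElement, Finsupp.single_apply]

theorem asAlgebraHom_groupAlgebraElement [Fintype G] {V : Type*} [AddCommGroup V] [Module ℂ V]
    (ρ : Representation ℂ G V) (f : G → ℂ) :
    ρ.asAlgebraHom (groupAlgebraElement f) = ∑ g, f g • ρ g := by
  simp [groupAlgebraElement]

/-- By Schur's lemma, a class function orthogonal to the character of an irreducible
representation acts on it by zero. -/
theorem asAlgebraHom_eq_zero_of_classFunction [Fintype G] {V : Type*} [AddCommGroup V] [Module ℂ V]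
    [FiniteDimensional ℂ V] (ρ : Representation ℂ G V) [ρ.IsIrreducible] {f : G → ℂ}
    (hf : ∀ x g, f (g * x * g⁻¹) = f x) (h : ∑ g, f g * ρ.character g = 0) :
    ρ.asAlgebraHom (groupAlgebraElement f) = 0 := by
  have hcomm : ∀ h : G, (∑ g, f g • ρ g) ∘ₗ ρ h = ρ h ∘ₗ (∑ g, f g • ρ g) := by
    intro h
    change (∑ g, f g • ρ g) * ρ h = ρ h * (∑ g, f g • ρ g)
    rw [Finset.sum_mul, Finset.mul_sum, ← Equiv.sum_comp (MulAut.conj h).toEquiv]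
    refine Finset.sum_congr rfl fun x _ => ?_
    simp [hf, ← map_mul]
  let T : Representation.IntertwiningMap ρ ρ := ⟨∑ g, f g • ρ g, hcomm⟩
  obtain ⟨c, hc⟩ :=
    (Representation.IsIrreducible.algebraMap_intertwiningMap_bijective_of_isAlgClosed
      (ρ := ρ)).2 T
  have hT : (∑ g, f g • ρ g) = c • LinearMap.id := by
    change T.toLinearMap = _
    rw [← hc, Algebra.algebraMap_eq_smul_one]
    rfl
  -- The trace of the scalar `c` is `c * dim V`, and `dim V ≠ 0`, so `c = 0`.
  have htr : LinearMap.trace ℂ V (∑ g, f g • ρ g) = 0 := by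
    simpa [Representation.character] using h
  have : Nontrivial V := by
    have : IsSimpleModule ℂ[G] ρ.asModule := inferInstance
    exact IsSimpleModule.nontrivial ℂ[G] ρ.asModule
  rw [asAlgebraHom_groupAlgebraElement, hT]
  rw [hT, map_smul, LinearMap.trace_id, smul_eq_mul, mul_eq_zero] at htr
  rcases htr with rfl | h0
  · simp
  · exact absurd (Nat.cast_eq_zero.mp h0) Module.finrank_pos.ne'

/-- Every simple module over the group algebra of a finite group is given by an irreducible
representation on some `Fin n → ℂ`. -/
theorem exists_representation_of_isSimpleModule [Finite G] (M : Type*) [AddCommGroup M]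
    [Module ℂ M] [Module ℂ[G] M] [IsScalarTower ℂ ℂ[G] M] [FiniteDimensional ℂ M]
    [IsSimpleModule ℂ[G] M] :
    ∃ (n : ℕ) (ρ : Representation ℂ G (Fin n → ℂ)) (e : M ≃ₗ[ℂ] (Fin n → ℂ)),
      ρ.IsIrreducible ∧ ∀ (r : ℂ[G]) (m : M), ρ.asAlgebraHom r (e m) = e (r • m) := by
  let e : M ≃ₗ[ℂ] (Fin (Module.finrank ℂ M) → ℂ) := (Module.finBasis ℂ M).equivFun
  let F : ℂ[G] →ₐ[ℂ] Module.End ℂ (Fin (Module.finrank ℂ M) → ℂ) :=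
    (LinearEquiv.conjAlgEquiv ℂ e).toAlgHom.comp (Algebra.lsmul ℂ ℂ M)
  let ρ : Representation ℂ G (Fin (Module.finrank ℂ M) → ℂ) := (MonoidAlgebra.lift ℂ _ G).symm F
  have hρ : ρ.asAlgebraHom = F := (MonoidAlgebra.lift ℂ _ G).apply_symm_apply F
  have he : ∀ (r : ℂ[G]) (m : M), ρ.asAlgebraHom r (e m) = e (r • m) := fun r m => by
    rw [hρ]
    simp [F]
  let e' : M ≃ₗ[ℂ[G]] ρ.asModule :=
    { e with map_smul' := fun r m => (he r m).symm }
  refine ⟨_, ρ, e, ?_, he⟩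
  rw [Representation.irreducible_iff_isSimpleModule_asModule]
  exact IsSimpleModule.congr e'.symm

/-- A class function orthogonal to all irreducible characters vanishes. -/
theorem classFunction_eq_zero [Fintype G] {f : G → ℂ} (hf : ∀ x g, f (g * x * g⁻¹) = f x)
    (h : ∀ χ : Irr G, ∑ g, f g * χ.1 g = 0) : f = 0 := by
  -- The element kills every simple quotient `ℂ[G] ⧸ I`, in particular the class of `1`, so it lies
  -- in every maximal left ideal `I`. The radical is zero by Maschke's theorem.
  have hmem : groupAlgebraElement f ∈ Ring.jacobson ℂ[G] := by
    rw [Ring.jacobson_eq_sInf_isMaximal, Submodule.mem_sInf]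
    intro I hI
    have : IsSimpleModule ℂ[G] (ℂ[G] ⧸ I) := isSimpleModule_iff_isCoatom.mpr (Set.mem_ofPred.mp hI).out
    have : FiniteDimensional ℂ ℂ[G] := inferInstance
    have : FiniteDimensional ℂ (ℂ[G] ⧸ I) :=
      Module.Finite.of_surjective (I.mkQ.restrictScalars ℂ) I.mkQ_surjective
    obtain ⟨n, ρ, e, hρ, he⟩ := exists_representation_of_isSimpleModule (G := G) (ℂ[G] ⧸ I)
    have h0 := asAlgebraHom_eq_zero_of_classFunction ρ hf (h ⟨_, n, ρ, hρ, rfl⟩)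
    have h1 := he (groupAlgebraElement f) (Submodule.Quotient.mk 1)
    rw [h0, LinearMap.zero_apply, eq_comm, e.map_eq_zero_iff, ← Submodule.Quotient.mk_smul,
      Submodule.Quotient.mk_eq_zero, smul_eq_mul, mul_one] at h1
    exact h1
  rw [IsSemisimpleRing.jacobson_eq_bot] at hmem
  funext g
  rw [← groupAlgebraElement_apply f g, (Submodule.mem_bot _).mp hmem]
  simp

end Representations

/-! ### Values and orthogonality of irreducible characters -/

section Characters

variable {G : Type*} [Group G]

theorem irr_conj (χ : Irr G) (x g : G) : χ.1 (g * x * g⁻¹) = χ.1 x := by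
  obtain ⟨_, n, ρ, hρ, rfl⟩ := χ
  exact ρ.char_conj x g

theorem irr_inv [Finite G] (χ : Irr G) (g : G) : χ.1 g⁻¹ = conj (χ.1 g) := by
  obtain ⟨_, n, ρ, hρ, rfl⟩ := χ
  exact character_inv_eq_conj ρ g

theorem irr_conj_one (χ : Irr G) : conj (χ.1 1) = χ.1 1 := by
  obtain ⟨_, n, ρ, hρ, rfl⟩ := χ
  simp

theorem irr_one_ne_zero (χ : Irr G) : χ.1 1 ≠ 0 := by
  obtain ⟨_, n, ρ, hρ, rfl⟩ := χ
  have : Nontrivial (Fin n → ℂ) := IsSimpleModule.nontrivial ℂ[G] ρ.asModule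
  change ρ.character 1 ≠ 0
  rw [Representation.char_one]
  exact Nat.cast_ne_zero.mpr Module.finrank_pos.ne'

open scoped Classical in
/-- Row orthogonality of irreducible characters. -/
theorem sum_irr_mul_conj [Fintype G] (χ ψ : Irr G) :
    ∑ g, conj (χ.1 g) * ψ.1 g = if χ = ψ then (Nat.card G : ℂ) else 0 := by
  have hc : (Nat.card G : ℂ) ≠ 0 := Nat.cast_ne_zero.mpr Nat.card_pos.ne'
  have : Invertible (Nat.card G : ℂ) := invertibleOfNonzero hc
  simp only [← irr_inv]
  have key : (Nat.card G : ℂ)⁻¹ * ∑ g, χ.1 g⁻¹ * ψ.1 g = if χ = ψ then 1 else 0 := by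
    simp only [mul_comm (χ.1 _)]
    obtain ⟨_, n, ρ, hρ, rfl⟩ := χ
    obtain ⟨_, m, τ, hτ, rfl⟩ := ψ
    rw [Representation.char_orthonormal]
    refine if_congr ⟨fun ⟨e⟩ => Subtype.ext (Representation.char_iso e), fun h => ?_⟩ rfl rfl
    have h : ρ.character = τ.character := congrArg Subtype.val h
    -- If the representations were not isomorphic, their equal characters would have inner product
    -- both `0` and `1`.
    by_contra hne
    have h1 := Representation.char_orthonormal τ ρ
    rw [if_neg hne, ← h, Representation.char_orthonormal,
      if_pos ⟨Representation.Equiv.refl ρ⟩] at h1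
    exact one_ne_zero h1
  rw [inv_mul_eq_iff_eq_mul₀ hc] at key
  rw [key]
  split_ifs <;> simp

end Characters

end Superchar

namespace Superchar

open scoped ComplexConjugate

/-! ### Partitions as spaces of functions -/

section SetoidFunctions

variable {α : Type*}

/-- The functions that are constant on the classes of `s`. -/
def setoidFunctions (s : Setoid α) : Submodule ℂ (α → ℂ) where
  carrier := {f | ∀ x y, s x y → f x = f y}
  zero_mem' _ _ _ := rfl
  add_mem' hf hg x y h := congrArg₂ (· + ·) (hf x y h) (hg x y h)
  smul_mem' c _ hf x y h := congrArg (c * ·) (hf x y h)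

theorem indicator_mem_setoidFunctions (s : Setoid α) {A : Set α} (hA : A ∈ s.classes) :
    A.indicator 1 ∈ setoidFunctions s := by
  classical
  obtain ⟨a, rfl⟩ := hA
  intro x y h
  have : s x a ↔ s y a := ⟨fun hx => s.trans (s.symm h) hx, fun hy => s.trans h hy⟩
  simp only [Set.indicator_apply, Set.mem_ofPred_eq]
  exact if_congr this rfl rfl

theorem le_of_setoidFunctions_le {s t : Setoid α} (h : setoidFunctions s ≤ setoidFunctions t) :
    t ≤ s := by
  classical
  intro x y hxy
  -- The indicator of the `s`-class of `y` separates `x` from `y` unless they are `s`-related.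
  have h1 := h (indicator_mem_setoidFunctions s ⟨y, rfl⟩) x y hxy
  by_contra hn
  simp [hn] at h1

/-- Functions constant on the classes of `s` are functions on the quotient. -/
def setoidFunctionsEquiv (s : Setoid α) : (Quotient s → ℂ) ≃ₗ[ℂ] setoidFunctions s where
  toFun c := ⟨fun x => c (Quotient.mk s x), fun _ _ h => congrArg c (Quotient.sound h)⟩
  invFun f := Quotient.lift f.1 f.2
  map_add' _ _ := rfl
  map_smul' _ _ := rfl
  left_inv c := by
    funext q
    induction q using Quotient.inductionOn
    rfl
  right_inv _ := rfl

theorem finrank_setoidFunctions [Finite α] (s : Setoid α) :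
    Module.finrank ℂ (setoidFunctions s) = s.classes.ncard := by
  have := Fintype.ofFinite (Quotient s)
  rw [← (setoidFunctionsEquiv s).finrank_eq, Module.finrank_pi, ← Nat.card_eq_fintype_card,
    Nat.card_congr s.quotientEquivClasses]
  rfl

/-- Indicators of classes span, so inclusions need only be tested on them. -/
theorem setoidFunctions_le_of_indicator [Finite α] {s : Setoid α} {p : Submodule ℂ (α → ℂ)}
    (h : ∀ A ∈ s.classes, A.indicator 1 ∈ p) : setoidFunctions s ≤ p := by
  classical
  have := Fintype.ofFinite (Quotient s)
  intro f hf
  have hsum : f = ∑ q : Quotient s, f q.out • Set.indicator {x | s x q.out} 1 := by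
    funext x
    rw [Finset.sum_apply, Finset.sum_eq_single (Quotient.mk s x)]
    · have hx : s x (Quotient.mk s x).out := s.symm (Quotient.mk_out x)
      simp [hx, ← hf _ _ hx]
    · intro q _ hq
      have : ¬ s x q.out := fun hx => hq ((Quotient.out_eq q).symm.trans (Quotient.sound hx).symm)
      simp [this]
    · simp
  rw [hsum]
  exact p.sum_mem fun q _ => p.smul_mem _ (h _ ⟨q.out, rfl⟩)

theorem refines_classes {s t : Setoid α} (h : s ≤ t) : Refines s.classes t.classes := by
  rintro _ ⟨a, rfl⟩
  exact ⟨_, ⟨a, rfl⟩, fun x hx => h hx⟩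

/-- An injective linear map carrying functions constant on the classes of `s` to functions constant
on the classes of `t` shows that `s` has at most as many classes as `t`, and is onto if the numbers
agree. -/
theorem ncard_classes_le_of_map_le {β : Type*} [Finite α] [Finite β] {s : Setoid α} {t : Setoid β}
    {T : (α → ℂ) →ₗ[ℂ] (β → ℂ)} (hT : Set.InjOn T (setoidFunctions s))
    (h : (setoidFunctions s).map T ≤ setoidFunctions t) :
    s.classes.ncard ≤ t.classes.ncard ∧
      (s.classes.ncard = t.classes.ncard → (setoidFunctions s).map T = setoidFunctions t) := by
  have hdim : Module.finrank ℂ ((setoidFunctions s).map T) = s.classes.ncard := by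
    rw [← finrank_setoidFunctions]
    rw [← LinearMap.range_domRestrict]
    exact LinearMap.finrank_range_of_inj (Set.injOn_iff_injective.mp hT)
  rw [← hdim, ← finrank_setoidFunctions]
  exact ⟨Submodule.finrank_mono h, fun heq => Submodule.eq_of_le_of_finrank_eq h heq⟩

end SetoidFunctions

/-! ### The two mutually inverse transforms -/

section Transform

variable {G : Type*} [Group G] [Fintype G]

/-- The central characters of the group algebra, evaluated at the element with coefficients `f`. -/
noncomputable def centralTransform : (G → ℂ) →ₗ[ℂ] (Irr G → ℂ) where
  toFun f χ := (∑ g, f g * χ.1 g) / χ.1 1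
  map_add' f f' := by
    funext χ
    simp [add_mul, Finset.sum_add_distrib, add_div]
  map_smul' c f := by
    funext χ
    simp [← Finset.mul_sum, mul_assoc, mul_div_assoc]

theorem centralTransform_apply (f : G → ℂ) (χ : Irr G) :
    centralTransform f χ = (∑ g, f g * χ.1 g) / χ.1 1 := rfl

theorem centralTransform_indicator (K : Set G) (χ : Irr G) :
    centralTransform (K.indicator 1) χ = charSum χ K / χ.1 1 := by
  classical
  rw [centralTransform_apply, charSum]
  congr 1
  simp only [Set.indicator_apply, Pi.one_apply, ite_mul, one_mul, zero_mul]
  rw [← Finset.sum_filter]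
  exact Finset.sum_congr (by ext; simp) fun _ _ => rfl

variable [Fintype (Irr G)]

/-- The inverse of `centralTransform` on class functions, up to the factor `|G|`. -/
noncomputable def idempotentTransform : (Irr G → ℂ) →ₗ[ℂ] (G → ℂ) where
  toFun c g := ∑ χ : Irr G, c χ * (χ.1 1 * conj (χ.1 g))
  map_add' c c' := by
    funext g
    simp [add_mul, Finset.sum_add_distrib]
  map_smul' a c := by
    funext g
    simp [Finset.mul_sum, mul_assoc]

omit [Fintype G] in
theorem idempotentTransform_apply (c : Irr G → ℂ) (g : G) :
    idempotentTransform c g = ∑ χ : Irr G, c χ * (χ.1 1 * conj (χ.1 g)) := rfl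

/-- The conjugation is harmless: it is injective, so it does not affect where `σ_X` is constant. -/
theorem idempotentTransform_indicator (X : Set (Irr G)) (g : G) :
    idempotentTransform (X.indicator 1) g = conj (sigma X g) := by
  classical
  rw [idempotentTransform_apply, sigma, map_sum]
  simp only [Set.indicator_apply, Pi.one_apply, ite_mul, one_mul, zero_mul, map_mul, irr_conj_one]
  rw [← Finset.sum_filter]
  exact Finset.sum_congr (by ext; simp) fun _ _ => rfl

omit [Fintype G] in
theorem idempotentTransform_conj (c : Irr G → ℂ) (x g : G) :
    idempotentTransform c (g * x * g⁻¹) = idempotentTransform c x := by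
  simp only [idempotentTransform_apply, irr_conj]

theorem centralTransform_idempotentTransform (c : Irr G → ℂ) :
    centralTransform (idempotentTransform c) = (Nat.card G : ℂ) • c := by
  classical
  funext ψ
  rw [centralTransform_apply, div_eq_iff (irr_one_ne_zero ψ)]
  calc ∑ g, (∑ χ : Irr G, c χ * (χ.1 1 * conj (χ.1 g))) * ψ.1 g
      = ∑ χ : Irr G, c χ * χ.1 1 * ∑ g, conj (χ.1 g) * ψ.1 g := by
        simp only [Finset.sum_mul, Finset.mul_sum]
        rw [Finset.sum_comm]
        exact Finset.sum_congr rfl fun _ _ => Finset.sum_congr rfl fun _ _ => by ring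
    _ = _ := by
        simp only [sum_irr_mul_conj, mul_ite, mul_zero, Finset.sum_ite_eq', Finset.mem_univ,
          if_true, Pi.smul_apply, smul_eq_mul]
        ring

/-- The difference of the two sides is a class function killed by `centralTransform`, hence
orthogonal to every irreducible character. -/
theorem idempotentTransform_centralTransform {f : G → ℂ} (hf : ∀ x g, f (g * x * g⁻¹) = f x) :
    idempotentTransform (centralTransform f) = (Nat.card G : ℂ) • f := by
  rw [← sub_eq_zero]
  apply classFunction_eq_zero
  · intro x g
    simp [idempotentTransform_conj, hf]
  · intro χ
    have h : centralTransform (idempotentTransform (centralTransform f) - (Nat.card G : ℂ) • f) χ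
        = 0 := by
      rw [map_sub, map_smul, centralTransform_idempotentTransform, sub_self]
      rfl
    rw [centralTransform_apply, div_eq_zero_iff] at h
    exact h.resolve_right (irr_one_ne_zero χ)

omit [Fintype (Irr G)] in
theorem card_group_ne_zero : (Nat.card G : ℂ) ≠ 0 := Nat.cast_ne_zero.mpr Nat.card_pos.ne'

theorem idempotentTransform_injective :
    Function.Injective (idempotentTransform (G := G)) := fun c c' h =>
  smul_right_injective _ (card_group_ne_zero (G := G)) (by
    simpa only [centralTransform_idempotentTransform] using congrArg centralTransform h)

end Transform

/-! ### The correspondence between partitions of `G` and of `Irr G` -/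

section Partitions

variable {G : Type*} [Group G] [Fintype G] [Fintype (Irr G)] {κ : Setoid G} {ξ : Setoid (Irr G)}

omit [Fintype G] [Fintype (Irr G)] in
theorem apply_conj_of_mem_setoidFunctions (hκ : ∀ x g, κ (g * x * g⁻¹) x) {f : G → ℂ}
    (hf : f ∈ setoidFunctions κ) (x g : G) : f (g * x * g⁻¹) = f x :=
  hf _ _ (hκ x g)

theorem centralTransform_injOn (hκ : ∀ x g, κ (g * x * g⁻¹) x) :
    Set.InjOn centralTransform (setoidFunctions κ : Set (G → ℂ)) := fun f hf f' hf' h =>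
  smul_right_injective _ (card_group_ne_zero (G := G)) (by
    simpa only [idempotentTransform_centralTransform (apply_conj_of_mem_setoidFunctions hκ hf),
      idempotentTransform_centralTransform (apply_conj_of_mem_setoidFunctions hκ hf')]
      using congrArg idempotentTransform h)

omit [Fintype (Irr G)] in
theorem clSetoid_conj (𝒳 : Set (Set (Irr G))) (x g : G) : clSetoid 𝒳 (g * x * g⁻¹) x := by
  intro X _
  simp only [sigma, irr_conj]

-- Half of the dictionary; taking `ξ = irSetoid κ.classes` gives the inclusion behind (a) and (c).
omit [Fintype (Irr G)] in
theorem map_centralTransform_le_iff :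
    (setoidFunctions κ).map centralTransform ≤ setoidFunctions ξ ↔ ξ ≤ irSetoid κ.classes := by
  constructor
  · intro h χ ψ hχψ K hK
    simpa only [centralTransform_indicator] using
      h (Submodule.mem_map_of_mem (indicator_mem_setoidFunctions κ hK)) χ ψ hχψ
  · intro h
    rw [Submodule.map_le_iff_le_comap]
    refine setoidFunctions_le_of_indicator fun K hK χ ψ hχψ => ?_
    simpa only [centralTransform_indicator] using h hχψ K hK

theorem map_idempotentTransform_le_iff :
    (setoidFunctions ξ).map idempotentTransform ≤ setoidFunctions κ ↔ κ ≤ clSetoid ξ.classes := by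
  constructor
  · intro h x y hxy X hX
    have := h (Submodule.mem_map_of_mem (indicator_mem_setoidFunctions ξ hX)) x y hxy
    rw [idempotentTransform_indicator, idempotentTransform_indicator] at this
    exact (starRingEnd ℂ).injective this
  · intro h
    rw [Submodule.map_le_iff_le_comap]
    refine setoidFunctions_le_of_indicator fun X hX x y hxy => ?_
    rw [idempotentTransform_indicator, idempotentTransform_indicator, h hxy X hX]

/-- A class function `f` is recovered from its transform as `|G|⁻¹ S T f`. -/
theorem le_map_idempotentTransform (hκ : ∀ x g, κ (g * x * g⁻¹) x)
    (h : (setoidFunctions κ).map centralTransform ≤ setoidFunctions ξ) :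
    setoidFunctions κ ≤ (setoidFunctions ξ).map idempotentTransform := fun f hf =>
  ⟨(Nat.card G : ℂ)⁻¹ • centralTransform f,
    Submodule.smul_mem _ _ (h (Submodule.mem_map_of_mem hf)), by
    rw [map_smul, idempotentTransform_centralTransform (apply_conj_of_mem_setoidFunctions hκ hf),
      inv_smul_smul₀ card_group_ne_zero]⟩

theorem le_map_centralTransform
    (h : (setoidFunctions ξ).map idempotentTransform ≤ setoidFunctions κ) :
    setoidFunctions ξ ≤ (setoidFunctions κ).map centralTransform := fun c hc =>
  ⟨(Nat.card G : ℂ)⁻¹ • idempotentTransform c,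
    Submodule.smul_mem _ _ (h (Submodule.mem_map_of_mem hc)), by
    rw [map_smul, centralTransform_idempotentTransform, inv_smul_smul₀ card_group_ne_zero]⟩

theorem map_idempotentTransform_of_map_centralTransform_eq (hκ : ∀ x g, κ (g * x * g⁻¹) x)
    (h : (setoidFunctions κ).map centralTransform = setoidFunctions ξ) :
    (setoidFunctions ξ).map idempotentTransform ≤ setoidFunctions κ := by
  rw [← h]
  rintro _ ⟨_, ⟨f, hf, rfl⟩, rfl⟩
  rw [idempotentTransform_centralTransform (apply_conj_of_mem_setoidFunctions hκ hf)]
  exact Submodule.smul_mem _ _ hf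

theorem map_centralTransform_of_map_idempotentTransform_eq
    (h : (setoidFunctions ξ).map idempotentTransform = setoidFunctions κ) :
    (setoidFunctions κ).map centralTransform ≤ setoidFunctions ξ := by
  rw [← h]
  rintro _ ⟨_, ⟨c, hc, rfl⟩, rfl⟩
  rw [centralTransform_idempotentTransform]
  exact Submodule.smul_mem _ _ hc

theorem ncard_classes_le_irSetoid (hκ : ∀ x g, κ (g * x * g⁻¹) x) :
    κ.classes.ncard ≤ (irSetoid κ.classes).classes.ncard :=
  (ncard_classes_le_of_map_le (centralTransform_injOn hκ)
    (map_centralTransform_le_iff.mpr le_rfl)).1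

/-- Equal dimensions make the embedding `T` onto, so its inverse `|G|⁻¹ S` returns to functions
constant on the classes of `κ`. -/
theorem le_clSetoid_irSetoid_of_ncard_eq (hκ : ∀ x g, κ (g * x * g⁻¹) x)
    (h : κ.classes.ncard = (irSetoid κ.classes).classes.ncard) :
    κ ≤ clSetoid (irSetoid κ.classes).classes :=
  map_idempotentTransform_le_iff.mp <| map_idempotentTransform_of_map_centralTransform_eq hκ <|
    (ncard_classes_le_of_map_le (centralTransform_injOn hκ)
      (map_centralTransform_le_iff.mpr le_rfl)).2 h

theorem ncard_classes_le_clSetoid (ξ : Setoid (Irr G)) :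
    ξ.classes.ncard ≤ (clSetoid ξ.classes).classes.ncard :=
  (ncard_classes_le_of_map_le idempotentTransform_injective.injOn
    (map_idempotentTransform_le_iff.mpr le_rfl)).1

theorem le_irSetoid_clSetoid_of_ncard_eq
    (h : ξ.classes.ncard = (clSetoid ξ.classes).classes.ncard) :
    ξ ≤ irSetoid (clSetoid ξ.classes).classes :=
  map_centralTransform_le_iff.mp <| map_centralTransform_of_map_idempotentTransform_eq <|
    (ncard_classes_le_of_map_le idempotentTransform_injective.injOn
      (map_idempotentTransform_le_iff.mpr le_rfl)).2 h

theorem clSetoid_irSetoid_le (hκ : ∀ x g, κ (g * x * g⁻¹) x) :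
    clSetoid (irSetoid κ.classes).classes ≤ κ :=
  le_of_setoidFunctions_le <|
    (le_map_idempotentTransform hκ (map_centralTransform_le_iff.mpr le_rfl)).trans
      (map_idempotentTransform_le_iff.mpr le_rfl)

theorem irSetoid_clSetoid_le (ξ : Setoid (Irr G)) :
    irSetoid (clSetoid ξ.classes).classes ≤ ξ :=
  le_of_setoidFunctions_le <|
    (le_map_centralTransform (map_idempotentTransform_le_iff.mpr le_rfl)).trans
      (map_centralTransform_le_iff.mpr le_rfl)

omit [Fintype (Irr G)] in
/-- The condition that all `σ_X` are constant on the members of `𝒦`, in terms of setoids. -/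
theorem isSupercharacterTheory_classes_iff :
    IsSupercharacterTheory ξ.classes κ.classes ↔
      ξ.classes.ncard = κ.classes.ncard ∧ κ ≤ clSetoid ξ.classes := by
  constructor
  · intro h
    exact ⟨h.card_eq, fun x y hxy X hX => h.const X hX _ ⟨y, rfl⟩ x hxy y (κ.refl y)⟩
  · rintro ⟨hcard, hle⟩
    refine ⟨Setoid.isPartition_classes ξ, Setoid.isPartition_classes κ, hcard, ?_⟩
    rintro X hX _ ⟨a, rfl⟩ x hx y hy
    exact hle (κ.trans hx (κ.symm hy)) X hX

theorem isSupercharacterTheory_irpt_iff_ncard (hκ : ∀ x g, κ (g * x * g⁻¹) x) :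
    κ.classes.ncard = (Irpt κ.classes).ncard ↔
      IsSupercharacterTheory (Irpt κ.classes) κ.classes := by
  rw [Irpt, isSupercharacterTheory_classes_iff]
  exact ⟨fun h => ⟨h.symm, le_clSetoid_irSetoid_of_ncard_eq hκ h⟩, fun h => h.1.symm⟩

omit [Fintype (Irr G)] in
theorem isSupercharacterTheory_clpt_iff_ncard (ξ : Setoid (Irr G)) :
    ξ.classes.ncard = (Clpt ξ.classes).ncard ↔
      IsSupercharacterTheory ξ.classes (Clpt ξ.classes) := by
  rw [Clpt, isSupercharacterTheory_classes_iff]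
  exact ⟨fun h => ⟨h, le_rfl⟩, fun h => h.1⟩

theorem isSupercharacterTheory_irpt_iff_clpt_irpt (hκ : ∀ x g, κ (g * x * g⁻¹) x) :
    Clpt (Irpt κ.classes) = κ.classes ↔ IsSupercharacterTheory (Irpt κ.classes) κ.classes := by
  rw [← isSupercharacterTheory_irpt_iff_ncard hκ, Clpt, Irpt]
  refine ⟨fun h => (ncard_classes_le_irSetoid hκ).antisymm ?_, fun h => Setoid.classes_inj.mp ?_⟩
  -- The sizes of `κ`, `Irpt`, `Clpt (Irpt)` increase weakly, and the last equals the first.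
  · exact (ncard_classes_le_clSetoid _).trans_eq (congrArg Set.ncard h)
  · exact (clSetoid_irSetoid_le hκ).antisymm (le_clSetoid_irSetoid_of_ncard_eq hκ h)

theorem isSupercharacterTheory_clpt_iff_irpt_clpt (ξ : Setoid (Irr G)) :
    Irpt (Clpt ξ.classes) = ξ.classes ↔ IsSupercharacterTheory ξ.classes (Clpt ξ.classes) := by
  rw [← isSupercharacterTheory_clpt_iff_ncard, Clpt, Irpt]
  refine ⟨fun h => (ncard_classes_le_clSetoid ξ).antisymm ?_, fun h => Setoid.classes_inj.mp ?_⟩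
  -- The same sandwich; `Clpt` is always `G`-invariant because the `σ_X` are class functions.
  · exact (ncard_classes_le_irSetoid (clSetoid_conj _)).trans_eq (congrArg Set.ncard h)
  · exact (irSetoid_clSetoid_le ξ).antisymm (le_irSetoid_clSetoid_of_ncard_eq h)

end Partitions

end Superchar

theorem theoremA {G : Type*} [Group G] [Finite G]
    (𝒦 : Set (Set G)) (h𝒦 : Setoid.IsPartition 𝒦) (hinv : Superchar.IsGInvariant 𝒦)
    (𝒳 : Set (Set (Superchar.Irr G))) (h𝒳 : Setoid.IsPartition 𝒳) :
    (𝒦.ncard ≤ (Superchar.Irpt 𝒦).ncard ∧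
      (𝒦.ncard = (Superchar.Irpt 𝒦).ncard ↔
        Superchar.IsSupercharacterTheory (Superchar.Irpt 𝒦) 𝒦)) ∧
    (𝒳.ncard ≤ (Superchar.Clpt 𝒳).ncard ∧
      (𝒳.ncard = (Superchar.Clpt 𝒳).ncard ↔
        Superchar.IsSupercharacterTheory 𝒳 (Superchar.Clpt 𝒳))) ∧
    (Superchar.Refines (Superchar.Clpt (Superchar.Irpt 𝒦)) 𝒦 ∧
      (Superchar.Clpt (Superchar.Irpt 𝒦) = 𝒦 ↔
        Superchar.IsSupercharacterTheory (Superchar.Irpt 𝒦) 𝒦)) ∧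
    (Superchar.Refines (Superchar.Irpt (Superchar.Clpt 𝒳)) 𝒳 ∧
      (Superchar.Irpt (Superchar.Clpt 𝒳) = 𝒳 ↔
        Superchar.IsSupercharacterTheory 𝒳 (Superchar.Clpt 𝒳))) := by
  open Superchar in
  have := Fintype.ofFinite G
  have := Fintype.ofFinite (Irr G)
  obtain ⟨κ, rfl⟩ : ∃ κ : Setoid G, κ.classes = 𝒦 := ⟨_, Setoid.classes_mkClasses 𝒦 h𝒦⟩
  obtain ⟨ξ, rfl⟩ : ∃ ξ : Setoid (Irr G), ξ.classes = 𝒳 := ⟨_, Setoid.classes_mkClasses 𝒳 h𝒳⟩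
  have hκ : ∀ x g, κ (g * x * g⁻¹) x := fun x g => hinv _ ⟨x, rfl⟩ x (κ.refl x) g
  exact ⟨⟨ncard_classes_le_irSetoid hκ, isSupercharacterTheory_irpt_iff_ncard hκ⟩,
    ⟨ncard_classes_le_clSetoid ξ, isSupercharacterTheory_clpt_iff_ncard ξ⟩,
    ⟨refines_classes (clSetoid_irSetoid_le hκ), isSupercharacterTheory_irpt_iff_clpt_irpt hκ⟩,
    ⟨refines_classes (irSetoid_clSetoid_le ξ), isSupercharacterTheory_clpt_iff_irpt_clpt ξ⟩⟩
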